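/- Let $\mathcal H$ be a finite-dimensional complex Hilbert space and let $\rho,\sigma$ be density matrices on $\mathcal H$, with $\sigma$ invertible. Let $D(\rho\|\sigma)=\operatorname{Tr}\rho(\log\rho-\log\sigma)$ (with $0\log 0=0$). For each $n$ let $M^n=\{M^n_\omega\}_{\omega\in\Omega_n}$ be a POVM on $\mathcal H^{\otimes n}$, i.e. a family of positive semidefinite operators with $\sum_\omega M^n_\omega=I$, and write $\vec M=\{M^n\}$. For a density matrix $\tau$ on $\mathcal H$ and a function $X$ on $\Omega_n$ let $\mathrm E^{M^n}_{\tau^{\otimes n}}(X)=\sum_{\omega\in\Omega_n}\operatorname{Tr}(M^n_\omega\tau^{\otimes n})\,X(\omega)$. For a sequence of tests $T^n:\Omega_n\to[0,1]$ put $\alpha_n=\mathrm E^{M^n}_{\rho^{\otimes n}}(1-T^n)$ and $\beta_n=\mathrm E^{M^n}_{\sigma^{\otimes n}}(T^n)$, and define $$B^{\dagger,\vec M}(\rho\|\sigma)=\sup\Big\{\lambda\in\mathbb R\;\Big|\;\exists\,\{T^n\}:\ \limsup_{n\to\infty}\alpha_n<1,\ \limsup_{n\to\infty}\tfrac1n\log\beta_n\le-\lambda\Big\},$$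 with $\log 0=-\infty$. Then every sequence $\vec M$ of POVMs satisfies $$B^{\dagger,\vec M}(\rho\|\sigma)\le D(\rho\|\sigma).$$ The same bound holds if the condition $\limsup_n\alpha_n<1$ in the definition is relaxed to $\liminf_n\alpha_n<1$, i.e. if one only requires that $\alpha_n$ does not tend to $1$. -/

import Mathlib

open Filter
open scoped ComplexOrder

noncomputable section

namespace QuantumTesting

/-- `ρ` is a density matrix on the finite-dimensional Hilbert space `ℂ^ι`. -/
structure IsDensity {ι : Type*} [Fintype ι] (ρ : Matrix ι ι ℂ) : Prop where
  posSemidef : ρ.PosSemidef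
  trace_eq_one : ρ.trace = 1

/-- The `n`-th tensor power `ρ^{⊗ n}`, as a matrix on `(ℂ^d)^{⊗ n}`, whose standard product basis
is indexed by `Fin n → d`. -/
def tensorPow {d : Type*} (ρ : Matrix d d ℂ) (n : ℕ) : Matrix (Fin n → d) (Fin n → d) ℂ :=
  Matrix.of fun i j => ∏ t, ρ (i t) (j t)

/-- The quantum relative entropy `D(ρ‖σ) = Tr ρ (log ρ - log σ)`, with natural logarithms taken by
functional calculus (for singular `ρ` this uses `0 log 0 = 0`, as `Real.log 0 = 0`). -/
def relEntropy {d : Type*} [Fintype d] [DecidableEq d] (ρ σ : Matrix d d ℂ) : ℝ :=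
  (ρ * (cfc Real.log ρ - cfc Real.log σ)).trace.re

/-- A POVM `{M_ω}` on `ℂ^ι` with data set `Ω` (finite or infinite): positive semidefinite matrices
that sum up to the identity. -/
structure POVM (Ω : Type*) (ι : Type*) [Fintype ι] [DecidableEq ι] where
  op : Ω → Matrix ι ι ℂ
  posSemidef : ∀ ω, (op ω).PosSemidef
  hasSum_one : HasSum op 1

/-- The probability `P_ρ^M(ω) = Tr M_ω ρ` of the datum `ω`. -/
def POVM.prob {Ω ι : Type*} [Fintype ι] [DecidableEq ι] (M : POVM Ω ι) (ρ : Matrix ι ι ℂ)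
    (ω : Ω) : ℝ :=
  (M.op ω * ρ).trace.re

/-- The expectation `E_ρ^M(X)` of `X` under `P_ρ^M`. -/
def POVM.expect {Ω ι : Type*} [Fintype ι] [DecidableEq ι] (M : POVM Ω ι) (ρ : Matrix ι ι ℂ)
    (X : Ω → ℝ) : ℝ :=
  ∑' ω, M.prob ρ ω * X ω

/-- A classical (randomized) test on the data set `Ω`: a function from `Ω` to `[0, 1]`, the
probability of accepting the null hypothesis. -/
def IsTest {Ω : Type*} (T : Ω → ℝ) : Prop := ∀ ω, 0 ≤ T ω ∧ T ω ≤ 1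

section Exponents

variable {d : Type*} [Fintype d] [DecidableEq d] {Ω : ℕ → Type*}

/-- The first error probability `E^{M^n}_{ρ^{⊗ n}}(1 - T^n)`. -/
def firstError (M : ∀ n, POVM (Ω n) (Fin n → d)) (ρ : Matrix d d ℂ) (T : ∀ n, Ω n → ℝ)
    (n : ℕ) : ℝ :=
  (M n).expect (tensorPow ρ n) (fun ω => 1 - T n ω)

/-- The second error probability `E^{M^n}_{σ^{⊗ n}}(T^n)`. -/
def secondError (M : ∀ n, POVM (Ω n) (Fin n → d)) (σ : Matrix d d ℂ) (T : ∀ n, Ω n → ℝ)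
    (n : ℕ) : ℝ :=
  (M n).expect (tensorPow σ n) (T n)

/-- `(1/n) log β_n` for the second error probability `β_n`, with `log 0 = -∞`. -/
def logSecondErrorRate (M : ∀ n, POVM (Ω n) (Fin n → d)) (σ : Matrix d d ℂ) (T : ∀ n, Ω n → ℝ)
    (n : ℕ) : EReal :=
  ((1 / (n : ℝ) : ℝ) : EReal) * ENNReal.log (ENNReal.ofReal (secondError M σ T n))

/-- `B^{†,M}(ρ‖σ)`: the supremum of all real `r` such that some sequence of tests has
`limsup α_n < 1` and `limsup (1/n) log β_n ≤ -r`. -/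
def Bdagger (M : ∀ n, POVM (Ω n) (Fin n → d)) (ρ σ : Matrix d d ℂ) : EReal :=
  sSup (((↑) : ℝ → EReal) '' {r : ℝ | ∃ T : ∀ n, Ω n → ℝ, (∀ n, IsTest (T n)) ∧
    limsup (fun n => (firstError M ρ T n : EReal)) atTop < 1 ∧
    limsup (logSecondErrorRate M σ T) atTop ≤ ((-r : ℝ) : EReal)})

/-- The variant of `B^{†,M}(ρ‖σ)` in which the first error probability is only required not to
tend to `1`, that is, `liminf α_n < 1`. -/
def BdaggerLiminf (M : ∀ n, POVM (Ω n) (Fin n → d)) (ρ σ : Matrix d d ℂ) : EReal :=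
  sSup (((↑) : ℝ → EReal) '' {r : ℝ | ∃ T : ∀ n, Ω n → ℝ, (∀ n, IsTest (T n)) ∧
    liminf (fun n => (firstError M ρ T n : EReal)) atTop < 1 ∧
    limsup (logSecondErrorRate M σ T) atTop ≤ ((-r : ℝ) : EReal)})

end Exponents

end QuantumTesting

end

namespace QuantumTesting

/-! ### Large deviations for i.i.d. sums on a finite alphabet. -/

section Chernoff

variable {d : Type*} [Fintype d]

/-! For any s > D(ρ‖σ), `exists_dominating` gives ρ^{⊗n} ≤ R + 2 exp(ns) σ^{⊗n} with R ≥ 0 and Tr R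
exponentially small. Pairing with a test gives 1 - α_n ≤ Tr R + 2 exp(ns) β_n for every POVM, so α_n
→ 1 as soon as β_n decays at a rate above s.

R collects the atypical parts: eigenvalues of ρ^{⊗n} that are too large, and eigenvectors of σ^{⊗n}
whose eigenvalue is too small. Its trace is a combination of two classical i.i.d. tails, with means
Tr ρ log ρ and -Tr ρ log σ, which `exists_chernoff_bound` controls. These means add up to D(ρ‖σ). -/

lemma sum_pi_prod (n : ℕ) (g : d → ℝ) : ∑ x : Fin n → d, ∏ t, g (x t) = (∑ i, g i) ^ n := by
  classical
  rw [← Fintype.piFinset_univ, Finset.sum_prod_piFinset]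
  simp

/-- Chernoff bound for an i.i.d. sum of a function on a finite probability space. -/
lemma exists_chernoff_bound (w f : d → ℝ) (hw : ∀ i, 0 ≤ w i) (hw1 : ∑ i, w i = 1) {a : ℝ}
    (ha : ∑ i, w i * f i < a) :
    ∃ c : ℝ, 0 ≤ c ∧ c < 1 ∧ ∀ n : ℕ,
      ∑ x : Fin n → d, (if n * a ≤ ∑ t, f (x t) then ∏ t, w (x t) else 0) ≤ c ^ n := by
  let φ : ℝ → ℝ := fun s => ∑ i, w i * Real.exp (s * (f i - a))
  have hφ0 : φ 0 = 1 := by simp [φ, hw1]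
  have hderiv : HasDerivAt φ (∑ i, w i * (f i - a)) 0 := by
    refine HasDerivAt.fun_sum fun i _ => ?_
    have h := ((hasDerivAt_id (0 : ℝ)).mul_const (f i - a)).exp.const_mul (w i)
    simpa using h
  have hneg : ∑ i, w i * (f i - a) < 0 := by
    simp only [mul_sub, Finset.sum_sub_distrib, ← Finset.sum_mul, hw1]
    linarith
  -- φ is the moment generating function of f - a; φ(0) = 1 and φ'(0) < 0, so it drops below 1 just
  -- to the right of 0.
  obtain ⟨s, hs0, hs⟩ : ∃ s : ℝ, 0 < s ∧ φ s < 1 := by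
    have h := hderiv.tendsto_slope_zero_right
    have h' := (h.eventually_lt_const hneg).and self_mem_nhdsWithin
    obtain ⟨s, hs, hs0⟩ := h'.exists
    refine ⟨s, hs0, ?_⟩
    have hs0' : (0 : ℝ) < s := hs0
    simp only [zero_add, hφ0, smul_eq_mul] at hs
    by_contra! h1
    exact hs.not_ge (mul_nonneg (inv_pos.2 hs0').le (sub_nonneg.2 h1))
  refine ⟨φ s, Finset.sum_nonneg fun i _ => mul_nonneg (hw i) (Real.exp_nonneg _), hs,
    fun n => ?_⟩
  rw [← sum_pi_prod]
  refine Finset.sum_le_sum fun x _ => ?_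
  have hprod : 0 ≤ ∏ t, w (x t) := Finset.prod_nonneg fun t _ => hw _
  rw [Finset.prod_mul_distrib, ← Real.exp_sum, ← Finset.mul_sum, Finset.sum_sub_distrib]
  split_ifs with h
  · refine le_mul_of_one_le_right hprod (Real.one_le_exp (mul_nonneg hs0.le ?_))
    simpa using h
  · positivity

end Chernoff

/-! ### Algebra of tensor powers. -/

section TensorPower

variable {d : Type*}

lemma tensorPow_mul [Fintype d] (A B : Matrix d d ℂ) (n : ℕ) :
    tensorPow (A * B) n = tensorPow A n * tensorPow B n := by
  classical
  ext i j
  simp only [tensorPow, Matrix.of_apply, Matrix.mul_apply, ← Finset.prod_mul_distrib]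
  rw [Finset.prod_univ_sum, Fintype.piFinset_univ]

lemma tensorPow_conjTranspose (A : Matrix d d ℂ) (n : ℕ) :
    tensorPow A.conjTranspose n = (tensorPow A n).conjTranspose := by
  ext i j
  simp [tensorPow]

lemma tensorPow_diagonal [DecidableEq d] (g : d → ℂ) (n : ℕ) :
    tensorPow (Matrix.diagonal g) n = Matrix.diagonal fun x => ∏ t, g (x t) := by
  ext i j
  simp only [tensorPow, Matrix.of_apply]
  by_cases h : i = j
  · subst h; simp
  · rw [Matrix.diagonal_apply_ne _ h]
    obtain ⟨t, ht⟩ := Function.ne_iff.1 h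
    exact Finset.prod_eq_zero (Finset.mem_univ t) (Matrix.diagonal_apply_ne _ ht)

lemma tensorPow_one [DecidableEq d] (n : ℕ) : tensorPow (1 : Matrix d d ℂ) n = 1 := by
  rw [← Matrix.diagonal_one, tensorPow_diagonal]
  simp

lemma trace_tensorPow [Fintype d] (A : Matrix d d ℂ) (n : ℕ) :
    (tensorPow A n).trace = A.trace ^ n := by
  classical
  simp only [Matrix.trace, Matrix.diag, tensorPow, Matrix.of_apply]
  rw [← Fintype.piFinset_univ, Finset.sum_prod_piFinset _ fun _ i => A i i]
  simp

end TensorPower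

/-! ### Spectral calculus and the dominating operator. -/

section UnitaryDiagonal

variable {ι : Type*} [Fintype ι] [DecidableEq ι]

/-- The matrix `U diag(p) U*`. -/
def conjDiag (U : Matrix ι ι ℂ) (p : ι → ℝ) : Matrix ι ι ℂ :=
  U * Matrix.diagonal (fun i => (p i : ℂ)) * U.conjTranspose

lemma conjDiag_posSemidef (U : Matrix ι ι ℂ) {p : ι → ℝ} (hp : ∀ i, 0 ≤ p i) :
    (conjDiag U p).PosSemidef :=
  (Matrix.PosSemidef.diagonal fun i => by simpa using hp i).mul_mul_conjTranspose_same U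

lemma conjDiag_add (U : Matrix ι ι ℂ) (p q : ι → ℝ) :
    conjDiag U (fun i => p i + q i) = conjDiag U p + conjDiag U q := by
  simp only [conjDiag, ← Matrix.add_mul, ← Matrix.mul_add, Matrix.diagonal_add, Complex.ofReal_add]

lemma conjDiag_const_mul (U : Matrix ι ι ℂ) (c : ℝ) (p : ι → ℝ) :
    conjDiag U (fun i => c * p i) = (c : ℂ) • conjDiag U p := by
  have : Matrix.diagonal (fun i => ((c * p i : ℝ) : ℂ)) =
      (c : ℂ) • Matrix.diagonal (fun i => (p i : ℂ)) := by
    ext i j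
    by_cases h : i = j
    · subst h; simp
    · simp [h]
  rw [conjDiag, this, conjDiag, Matrix.mul_smul, Matrix.smul_mul]

lemma conjDiag_one {U : Matrix ι ι ℂ} (hU : U * U.conjTranspose = 1) :
    conjDiag U (fun _ => 1) = 1 := by
  simp [conjDiag, hU]

lemma conjDiag_mul {U : Matrix ι ι ℂ} (hU : U.conjTranspose * U = 1) (p q : ι → ℝ) :
    conjDiag U p * conjDiag U q = conjDiag U (fun i => p i * q i) := by
  simp only [conjDiag, Complex.ofReal_mul, ← Matrix.diagonal_mul_diagonal]
  calc _ = U * Matrix.diagonal (fun i => (p i : ℂ)) * (U.conjTranspose * U) *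
        Matrix.diagonal (fun i => (q i : ℂ)) * U.conjTranspose := by simp only [Matrix.mul_assoc]
    _ = _ := by rw [hU]; simp only [Matrix.mul_assoc, Matrix.one_mul]

lemma trace_mul_conjDiag (A U : Matrix ι ι ℂ) (p : ι → ℝ) :
    (A * conjDiag U p).trace = ∑ i, (U.conjTranspose * A * U) i i * p i := by
  rw [conjDiag, ← Matrix.mul_assoc, Matrix.trace_mul_comm, ← Matrix.mul_assoc, ← Matrix.mul_assoc]
  simp [Matrix.trace, Matrix.mul_diagonal]

lemma conjTranspose_mul_conjDiag_mul {U : Matrix ι ι ℂ} (hU : U.conjTranspose * U = 1)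
    (p : ι → ℝ) :
    U.conjTranspose * conjDiag U p * U = Matrix.diagonal (fun i => (p i : ℂ)) := by
  calc _ = (U.conjTranspose * U) * Matrix.diagonal (fun i => (p i : ℂ)) *
        (U.conjTranspose * U) := by simp only [conjDiag, Matrix.mul_assoc]
    _ = _ := by simp [hU]

lemma trace_conjDiag {U : Matrix ι ι ℂ} (hU : U.conjTranspose * U = 1) (p : ι → ℝ) :
    (conjDiag U p).trace = ∑ i, (p i : ℂ) := by
  rw [← Matrix.one_mul (conjDiag U p), trace_mul_conjDiag]
  simp [hU]

lemma tensorPow_conjDiag (U : Matrix ι ι ℂ) (p : ι → ℝ) (n : ℕ) :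
    tensorPow (conjDiag U p) n = conjDiag (tensorPow U n) (fun x => ∏ t, p (x t)) := by
  simp [conjDiag, tensorPow_mul, tensorPow_diagonal, tensorPow_conjTranspose]

lemma exists_conjDiag {A : Matrix ι ι ℂ} (hA : A.IsHermitian) :
    ∃ U : Matrix ι ι ℂ, U.conjTranspose * U = 1 ∧ U * U.conjTranspose = 1 ∧
      A = conjDiag U hA.eigenvalues ∧
      ∀ f : ℝ → ℝ, cfc f A = conjDiag U (fun i => f (hA.eigenvalues i)) := by
  refine ⟨hA.eigenvectorUnitary, Unitary.coe_star_mul_self _, Unitary.coe_mul_star_self _, ?_,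
    fun f => ?_⟩
  · conv_lhs => rw [hA.spectral_theorem]
    rfl
  · rw [hA.cfc_eq]
    rfl

/-- The operator inequality behind the strong converse: up to a positive semidefinite matrix
whose trace is small when `S` and `S'` are unlikely, `U diag(p) U*` is dominated by a multiple of
`V diag(q) V*`. -/
lemma exists_dominating {U V : Matrix ι ι ℂ} (hU : U.conjTranspose * U = 1)
    (hU' : U * U.conjTranspose = 1) (hV : V.conjTranspose * V = 1) (hV' : V * V.conjTranspose = 1)
    {p q : ι → ℝ} (hp : ∀ i, 0 ≤ p i) (hq : ∀ i, 0 ≤ q i) (S S' : ι → Prop) [DecidablePred S]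
    [DecidablePred S'] {a c : ℝ} (ha : 0 ≤ a) (hc : 0 ≤ c) (hS : ∀ i, ¬ S i → p i ≤ a)
    (hS' : ∀ i, ¬ S' i → a ≤ c * q i) :
    ∃ R : Matrix ι ι ℂ, R.PosSemidef ∧
      R.trace = ∑ i, (if S i then (p i : ℂ) else 0) +
        2 * ∑ i, (if S' i then (V.conjTranspose * conjDiag U p * V) i i else 0) ∧
      (R + (2 * c : ℂ) • conjDiag V q - conjDiag U p).PosSemidef := by
  set ρ := conjDiag U p with hρ
  set σ := conjDiag V q with hσ
  set ρ₁ := conjDiag U (fun i => if S i then 0 else p i) with hρ₁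
  set ρ₂ := conjDiag U (fun i => if S i then p i else 0) with hρ₂
  set Q := conjDiag V (fun i => if S' i then 0 else 1) with hQ
  set Q' := conjDiag V (fun i => if S' i then 1 else 0) with hQ'
  have hρ_add : ρ = ρ₁ + ρ₂ := by
    rw [hρ₁, hρ₂, ← conjDiag_add, hρ]
    congr 1; ext i; split_ifs <;> simp
  have hQ_add : Q = 1 - Q' := by
    rw [eq_sub_iff_add_eq, ← conjDiag_one hV', hQ, hQ', ← conjDiag_add]
    congr 1; ext i; split_ifs <;> simp
  have hQQ : Q * Q = Q := by
    rw [hQ, conjDiag_mul hV]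
    congr 1; ext i; split_ifs <;> simp
  have hQQ' : Q' * Q' = Q' := by
    rw [hQ', conjDiag_mul hV]
    congr 1; ext i; split_ifs <;> simp
  have hρ₁_pos : ρ₁.PosSemidef := conjDiag_posSemidef U fun i => by split_ifs <;> simp [hp]
  have hρ₂_pos : ρ₂.PosSemidef := conjDiag_posSemidef U fun i => by split_ifs <;> simp [hp]
  have hQ_herm : Q.conjTranspose = Q :=
    (conjDiag_posSemidef V fun i => by split_ifs <;> simp).isHermitian
  have hQ_herm' : Q'.conjTranspose = Q' :=
    (conjDiag_posSemidef V fun i => by split_ifs <;> simp).isHermitian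
  have hF : ((a : ℂ) • 1 - ρ₁).PosSemidef := by
    have : (a : ℂ) • 1 - ρ₁ = conjDiag U (fun i => a - if S i then 0 else p i) := by
      rw [sub_eq_iff_eq_add, hρ₁, ← conjDiag_add, ← conjDiag_one hU', ← conjDiag_const_mul]
      simp
    rw [this]
    refine conjDiag_posSemidef U fun i => ?_
    split_ifs with h
    · simpa using ha
    · simpa using hS i h
  have hE : ((c : ℂ) • σ - (a : ℂ) • Q).PosSemidef := by
    have : (c : ℂ) • σ - (a : ℂ) • Q =
        conjDiag V (fun i => c * q i - a * if S' i then 0 else 1) := by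
      rw [sub_eq_iff_eq_add, hσ, hQ, ← conjDiag_const_mul, ← conjDiag_const_mul, ← conjDiag_add]
      simp
    rw [this]
    refine conjDiag_posSemidef V fun i => ?_
    split_ifs with h
    · simpa using mul_nonneg hc (hq i)
    · simpa using hS' i h
  have h2 : (0 : ℂ) ≤ 2 := by norm_num
  have hρ_pos : ρ.PosSemidef := conjDiag_posSemidef U hp
  have conj_pos : ∀ {X Y : Matrix ι ι ℂ}, X.PosSemidef → Y.conjTranspose = Y →
      (Y * X * Y).PosSemidef := by
    intro X Y hX hY
    simpa [hY] using hX.mul_mul_conjTranspose_same Y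
  refine ⟨ρ₂ + (2 : ℂ) • (Q' * ρ * Q'), hρ₂_pos.add ((conj_pos hρ_pos hQ_herm').smul h2), ?_, ?_⟩
  · rw [Matrix.trace_add, Matrix.trace_smul, Matrix.trace_mul_cycle, hQQ', Matrix.trace_mul_comm,
      hρ₂, trace_conjDiag hU, hQ', trace_mul_conjDiag]
    simp [apply_ite]
  -- Pinching: since Q + Q' = 1, 2Qρ₁Q + 2Q'ρ₁Q' - ρ₁ = (Q - Q')ρ₁(Q - Q') ≥ 0. This is the source
  -- of the factor 2 and replaces commutativity of ρ and σ. The Q-block is then bounded via Qρ₁Q ≤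
  -- aQ ≤ cσ.
  · have key : ρ₂ + (2 : ℂ) • (Q' * ρ * Q') + (2 * c : ℂ) • σ - ρ =
        (Q - Q') * ρ₁ * (Q - Q') + (2 : ℂ) • (Q' * ρ₂ * Q') +
          (2 : ℂ) • (Q * ((a : ℂ) • 1 - ρ₁) * Q) + (2 : ℂ) • ((c : ℂ) • σ - (a : ℂ) • Q) := by
      have e : Q * ((a : ℂ) • 1 - ρ₁) * Q = (a : ℂ) • Q - Q * ρ₁ * Q := by
        rw [mul_sub, sub_mul, mul_smul_comm, mul_one, smul_mul_assoc, hQQ]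
      rw [e, hρ_add, mul_smul, two_smul, two_smul, two_smul, two_smul, two_smul]
      generalize (c : ℂ) • σ = Z
      generalize (a : ℂ) • Q = Y
      rw [hQ_add]
      noncomm_ring
    rw [key]
    have hherm : (Q - Q').conjTranspose = Q - Q' := by
      rw [Matrix.conjTranspose_sub, hQ_herm, hQ_herm']
    exact (((conj_pos hρ₁_pos hherm).add ((conj_pos hρ₂_pos hQ_herm').smul h2)).add
      ((conj_pos hF hQ_herm).smul h2)).add (hE.smul h2)

end UnitaryDiagonal

/-! ### Expectations under a POVM. -/

section Measurement

variable {Ω ι : Type*} [Fintype ι] [DecidableEq ι]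

lemma trace_mul_re_nonneg {A B : Matrix ι ι ℂ} (hA : A.PosSemidef) (hB : B.PosSemidef) :
    0 ≤ (A * B).trace.re := by
  obtain ⟨U, -, -, hBU, -⟩ := exists_conjDiag hB.isHermitian
  rw [hBU, trace_mul_conjDiag]
  have h : (0 : ℂ) ≤ ∑ i, (U.conjTranspose * A * U) i i * (hB.isHermitian.eigenvalues i : ℂ) :=
    Finset.sum_nonneg fun i _ => mul_nonneg (hA.conjTranspose_mul_mul_same U).diag_nonneg
      (by simpa using hB.eigenvalues_nonneg i)
  exact (Complex.le_def.1 h).1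

lemma POVM.prob_nonneg (M : POVM Ω ι) {A : Matrix ι ι ℂ} (hA : A.PosSemidef) (ω : Ω) :
    0 ≤ M.prob A ω :=
  trace_mul_re_nonneg (M.posSemidef ω) hA

lemma POVM.hasSum_prob (M : POVM Ω ι) (A : Matrix ι ι ℂ) :
    HasSum (M.prob A) A.trace.re := by
  let φ : Matrix ι ι ℂ →+ ℝ :=
    { toFun := fun B => (B * A).trace.re
      map_zero' := by simp
      map_add' := fun B C => by simp [add_mul] }
  have hφ : Continuous φ := by
    change Continuous fun B : Matrix ι ι ℂ => (B * A).trace.re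
    fun_prop
  have h := M.hasSum_one.map φ hφ
  have h1 : φ 1 = A.trace.re := by simp [φ]
  rw [h1] at h
  exact h

lemma POVM.summable_prob_mul (M : POVM Ω ι) {A : Matrix ι ι ℂ} (hA : A.PosSemidef) {T : Ω → ℝ}
    (hT : IsTest T) : Summable fun ω => M.prob A ω * T ω :=
  (M.hasSum_prob A).summable.of_nonneg_of_le
    (fun ω => mul_nonneg (M.prob_nonneg hA ω) (hT ω).1)
    (fun ω => mul_le_of_le_one_right (M.prob_nonneg hA ω) (hT ω).2)

lemma POVM.expect_one_sub (M : POVM Ω ι) {A : Matrix ι ι ℂ} (hA : A.PosSemidef) {T : Ω → ℝ}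
    (hT : IsTest T) : M.expect A (fun ω => 1 - T ω) = A.trace.re - M.expect A T := by
  have h := (M.hasSum_prob A).sub (M.summable_prob_mul hA hT).hasSum
  simp only [expect, mul_sub, mul_one]
  exact h.tsum_eq

/-- The operator inequality passes to each outcome probability; T ≤ 1 lets the R-term be summed to
its full trace. -/
lemma POVM.expect_le_of_dominated (M : POVM Ω ι) {A B R : Matrix ι ι ℂ} {c : ℝ}
    (hA : A.PosSemidef) (hB : B.PosSemidef) (hR : R.PosSemidef)
    (h : (R + (c : ℂ) • B - A).PosSemidef) {T : Ω → ℝ} (hT : IsTest T) :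
    M.expect A T ≤ R.trace.re + c * M.expect B T := by
  have hsum := (M.hasSum_prob R).add ((M.summable_prob_mul hB hT).hasSum.mul_left c)
  refine hasSum_le (fun ω => ?_) (M.summable_prob_mul hA hT).hasSum hsum
  have h1 : M.prob A ω ≤ M.prob R ω + c * M.prob B ω := by
    have := trace_mul_re_nonneg (M.posSemidef ω) h
    simp only [mul_sub, mul_add, Matrix.mul_smul, Matrix.trace_sub, Matrix.trace_add,
      Matrix.trace_smul, Complex.sub_re, Complex.add_re, smul_eq_mul, Complex.re_ofReal_mul] at this
    simp only [prob]
    linarith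
  have h2 := mul_le_mul_of_nonneg_right h1 (hT ω).1
  have h3 := mul_le_of_le_one_right (M.prob_nonneg hR ω) (hT ω).2
  linarith

end Measurement

/-! ### The strong converse. -/

section StrongConverse

variable {d : Type*} [Fintype d] [DecidableEq d] {Ω : ℕ → Type*}

lemma tensorPow_posSemidef {A : Matrix d d ℂ} (hA : A.PosSemidef) (n : ℕ) :
    (tensorPow A n).PosSemidef := by
  obtain ⟨U, -, -, hAU, -⟩ := exists_conjDiag hA.isHermitian
  rw [hAU, tensorPow_conjDiag]
  exact conjDiag_posSemidef _ fun x => Finset.prod_nonneg fun t _ => hA.eigenvalues_nonneg _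

lemma prod_le_exp_of_sum_log_lt {n : ℕ} {p : Fin n → ℝ} (hp : ∀ t, 0 ≤ p t) {a : ℝ}
    (h : ∑ t, Real.log (p t) < a) : ∏ t, p t ≤ Real.exp a := by
  -- As `Real.log 0 = 0`, the sum of logarithms misses zero factors, but then the product vanishes.
  by_cases h0 : ∃ t, p t = 0
  · obtain ⟨t, ht⟩ := h0
    rw [Finset.prod_eq_zero (Finset.mem_univ t) ht]
    exact Real.exp_nonneg a
  · push Not at h0
    calc ∏ t, p t = Real.exp (∑ t, Real.log (p t)) := by
          rw [Real.exp_sum]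
          exact Finset.prod_congr rfl fun t _ => (Real.exp_log ((hp t).lt_of_ne' (h0 t))).symm
      _ ≤ _ := Real.exp_le_exp.2 h.le

/-- Quantitative strong converse: no test separates `ρ^{⊗ n}` from `σ^{⊗ n}` at a rate above the
relative entropy. -/
lemma exists_firstError_lower_bound {ρ σ : Matrix d d ℂ} (hρ : IsDensity ρ) (hσ : σ.PosDef)
    (M : ∀ n, POVM (Ω n) (Fin n → d)) {s : ℝ} (hs : relEntropy ρ σ < s) :
    ∃ c₁ c₂ : ℝ, 0 ≤ c₁ ∧ c₁ < 1 ∧ 0 ≤ c₂ ∧ c₂ < 1 ∧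
      ∀ T : ∀ n, Ω n → ℝ, (∀ n, IsTest (T n)) → ∀ n : ℕ,
        1 - (c₁ ^ n + 2 * c₂ ^ n + 2 * Real.exp (n * s) * secondError M σ T n) ≤
          firstError M ρ T n := by
  obtain ⟨U, hU, hU', hρU, hlogρ⟩ := exists_conjDiag hρ.posSemidef.isHermitian
  obtain ⟨V, hV, hV', hσV, hlogσ⟩ := exists_conjDiag hσ.posSemidef.isHermitian
  have hp := hρ.posSemidef.eigenvalues_nonneg
  have hq := hσ.eigenvalues_pos
  set p := hρ.posSemidef.isHermitian.eigenvalues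
  set q := hσ.posSemidef.isHermitian.eigenvalues
  have hr : ∀ i, 0 ≤ (V.conjTranspose * ρ * V) i i := fun i =>
    (hρ.posSemidef.conjTranspose_mul_mul_same V).diag_nonneg
  have hr_trace : (V.conjTranspose * ρ * V).trace = 1 := by
    rw [Matrix.trace_mul_cycle, hV', Matrix.one_mul, hρ.trace_eq_one]
  -- The outcome distribution of ρ measured in the eigenbasis of σ.
  set r : d → ℝ := fun i => ((V.conjTranspose * ρ * V) i i).re
  have hr_nonneg : ∀ i, 0 ≤ r i := fun i => (Complex.le_def.1 (hr i)).1
  have hr_eq : ∀ i, (V.conjTranspose * ρ * V) i i = (r i : ℂ) := fun i =>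
    Complex.ext rfl (Complex.le_def.1 (hr i)).2.symm
  have hr_sum : ∑ i, r i = 1 := by
    have := congrArg Complex.re hr_trace
    simpa [Matrix.trace] using this
  have hp_sum : ∑ i, p i = 1 := by
    have h := hρ.trace_eq_one
    rw [hρU, trace_conjDiag hU] at h
    exact_mod_cast h
  have hD : relEntropy ρ σ =
      ∑ i, p i * Real.log (p i) + ∑ i, r i * -Real.log (q i) := by
    have hUU : ∀ i, (U.conjTranspose * ρ * U) i i = (p i : ℂ) := fun i => by
      rw [hρU, conjTranspose_mul_conjDiag_mul hU, Matrix.diagonal_apply_eq]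
    rw [relEntropy, hlogρ, hlogσ, mul_sub, Matrix.trace_sub, trace_mul_conjDiag,
      trace_mul_conjDiag]
    simp only [hUU, hr_eq, mul_neg, Finset.sum_neg_distrib, ← sub_eq_add_neg]
    rw [← Complex.ofReal_re (_ - _)]
    push_cast
    rfl
  -- Half of the gap goes to each tail, so that the thresholds satisfy a + b = s.
  set ε := (s - relEntropy ρ σ) / 2 with hε
  have hε0 : 0 < ε := by rw [hε]; linarith
  obtain ⟨c₁, hc₁, hc₁', hP⟩ := exists_chernoff_bound p (fun i => Real.log (p i)) hp hp_sum
    (lt_add_of_pos_right _ hε0)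
  obtain ⟨c₂, hc₂, hc₂', hQ⟩ := exists_chernoff_bound r (fun i => -Real.log (q i)) hr_nonneg hr_sum
    (lt_add_of_pos_right _ hε0)
  set a := ∑ i, p i * Real.log (p i) + ε
  set b := ∑ i, r i * -Real.log (q i) + ε
  have hab : a + b = s := by linarith
  refine ⟨c₁, c₂, hc₁, hc₁', hc₂, hc₂', fun T hT n => ?_⟩
  have unitary : ∀ {A B : Matrix d d ℂ}, A * B = 1 → tensorPow A n * tensorPow B n = 1 :=
    fun h => by rw [← tensorPow_mul, h, tensorPow_one]
  obtain ⟨R, hR, hR_trace, hdom⟩ := exists_dominating (U := tensorPow U n) (V := tensorPow V n)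
    (by rw [← tensorPow_conjTranspose]; exact unitary hU)
    (by rw [← tensorPow_conjTranspose]; exact unitary hU')
    (by rw [← tensorPow_conjTranspose]; exact unitary hV)
    (by rw [← tensorPow_conjTranspose]; exact unitary hV')
    (p := fun x => ∏ t, p (x t)) (q := fun x => ∏ t, q (x t))
    (fun x => Finset.prod_nonneg fun t _ => hp _)
    (fun x => Finset.prod_nonneg fun t _ => (hq _).le)
    (fun x => n * a ≤ ∑ t, Real.log (p (x t)))
    (fun x => n * b ≤ ∑ t, -Real.log (q (x t)))
    (Real.exp_nonneg (n * a)) (Real.exp_nonneg (n * s))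
    (fun x hx => prod_le_exp_of_sum_log_lt (fun t => hp _) (not_le.1 hx))
    (fun x hx => by
      have hx' : -(n * b) ≤ ∑ t, Real.log (q (x t)) := by
        rw [not_le, Finset.sum_neg_distrib] at hx
        linarith
      have hprod : ∏ t, q (x t) = Real.exp (∑ t, Real.log (q (x t))) := by
        rw [Real.exp_sum]
        exact Finset.prod_congr rfl fun t _ => (Real.exp_log (hq _)).symm
      rw [hprod, ← Real.exp_add, Real.exp_le_exp, ← hab]
      linarith)
  rw [← tensorPow_conjDiag, ← tensorPow_conjDiag, ← hρU, ← hσV] at hdom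
  rw [← tensorPow_conjDiag, ← hρU, ← tensorPow_conjTranspose, ← tensorPow_mul,
    ← tensorPow_mul] at hR_trace
  have hR_le : R.trace.re ≤ c₁ ^ n + 2 * c₂ ^ n := by
    have : R.trace.re = ∑ x : Fin n → d,
          (if n * a ≤ ∑ t, Real.log (p (x t)) then ∏ t, p (x t) else 0) +
        2 * ∑ x : Fin n → d,
          (if n * b ≤ ∑ t, -Real.log (q (x t)) then ∏ t, r (x t) else 0) := by
      rw [← Complex.ofReal_re (_ + _), hR_trace]
      congr 1
      push_cast
      simp only [tensorPow, Matrix.of_apply, hr_eq, apply_ite Complex.ofReal, Complex.ofReal_prod,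
        Complex.ofReal_zero]
    rw [this]
    linarith [hP n, hQ n]
  have hρn := tensorPow_posSemidef hρ.posSemidef n
  have hσn := tensorPow_posSemidef hσ.posSemidef n
  have hmain := (M n).expect_le_of_dominated (c := 2 * Real.exp (n * s)) hρn hσn hR
    (by exact_mod_cast hdom) (hT n)
  rw [firstError, (M n).expect_one_sub hρn (hT n), trace_tensorPow, hρ.trace_eq_one, secondError]
  simp only [one_pow, Complex.one_re]
  linarith

lemma lt_exp_of_log_rate_lt {n : ℕ} (hn : 0 < n) {β s : ℝ}
    (h : ((1 / (n : ℝ) : ℝ) : EReal) * ENNReal.log (ENNReal.ofReal β) < ((-s : ℝ) : EReal)) :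
    β < Real.exp (-(n * s)) := by
  rcases le_or_gt β 0 with hβ | hβ
  · exact hβ.trans_lt (Real.exp_pos _)
  · have hn' : (0 : ℝ) < n := Nat.cast_pos.2 hn
    rw [ENNReal.log_ofReal_of_pos hβ, ← EReal.coe_mul, EReal.coe_lt_coe_iff] at h
    rw [← Real.log_lt_iff_lt_exp hβ]
    have := mul_lt_mul_of_pos_left h hn'
    rw [← mul_assoc, mul_one_div_cancel hn'.ne', one_mul] at this
    linarith

/-- If the second error decays at a rate above the relative entropy, the first error tends
to one. -/
lemma one_le_liminf_firstError {ρ σ : Matrix d d ℂ} (hρ : IsDensity ρ) (hσ : σ.PosDef)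
    (M : ∀ n, POVM (Ω n) (Fin n → d)) {T : ∀ n, Ω n → ℝ} (hT : ∀ n, IsTest (T n)) {r : ℝ}
    (hr : relEntropy ρ σ < r)
    (hβ : limsup (logSecondErrorRate M σ T) atTop ≤ ((-r : ℝ) : EReal)) :
    1 ≤ liminf (fun n => (firstError M ρ T n : EReal)) atTop := by
  -- With D(ρ‖σ) < s < u < r, eventually β_n < exp(-nu), and exp(ns) β_n is at most exp(s - u)^n →
  -- 0.
  obtain ⟨s, hs, hsr⟩ := exists_between hr
  obtain ⟨u, hsu, hur⟩ := exists_between hsr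
  obtain ⟨c₁, c₂, hc₁, hc₁', hc₂, hc₂', hbound⟩ := exists_firstError_lower_bound hρ hσ M hs
  have hev : ∀ᶠ n in atTop, logSecondErrorRate M σ T n < ((-u : ℝ) : EReal) :=
    eventually_lt_of_limsup_lt (hβ.trans_lt (EReal.coe_lt_coe_iff.2 (neg_lt_neg hur)))
  have hexp : Real.exp (s - u) < 1 := by simpa using hsu
  have hlim : Tendsto (fun n : ℕ => 1 - (c₁ ^ n + 2 * c₂ ^ n + 2 * Real.exp (s - u) ^ n)) atTop
      (nhds 1) := by
    have h := ((tendsto_pow_atTop_nhds_zero_of_lt_one hc₁ hc₁').add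
      ((tendsto_pow_atTop_nhds_zero_of_lt_one hc₂ hc₂').const_mul 2)).add
      ((tendsto_pow_atTop_nhds_zero_of_lt_one (Real.exp_nonneg _) hexp).const_mul 2)
    simpa using h.const_sub 1
  have hle : ∀ᶠ n : ℕ in atTop,
      ((1 - (c₁ ^ n + 2 * c₂ ^ n + 2 * Real.exp (s - u) ^ n) : ℝ) : EReal) ≤
        (firstError M ρ T n : EReal) := by
    filter_upwards [hev, eventually_gt_atTop 0] with n hn hn0
    refine EReal.coe_le_coe_iff.2 (le_trans ?_ (hbound T hT n))
    have h := mul_le_mul_of_nonneg_left (lt_exp_of_log_rate_lt hn0 hn).le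
      (Real.exp_nonneg (n * s))
    rw [← Real.exp_add] at h
    have h' : Real.exp (s - u) ^ n = Real.exp (n * s + -(n * u)) := by
      rw [← Real.exp_nat_mul]
      congr 1
      ring
    rw [h']
    linarith
  have hlim' := (continuous_coe_real_ereal.tendsto 1).comp hlim
  calc (1 : EReal) = liminf (fun n : ℕ =>
        ((1 - (c₁ ^ n + 2 * c₂ ^ n + 2 * Real.exp (s - u) ^ n) : ℝ) : EReal)) atTop :=
        hlim'.liminf_eq.symm
    _ ≤ _ := liminf_le_liminf hle

lemma Bdagger_le_BdaggerLiminf (M : ∀ n, POVM (Ω n) (Fin n → d)) (ρ σ : Matrix d d ℂ) :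
    Bdagger M ρ σ ≤ BdaggerLiminf M ρ σ :=
  sSup_le_sSup <| Set.image_mono fun _ ⟨T, hT, hα, hβ⟩ =>
    ⟨T, hT, lt_of_le_of_lt liminf_le_limsup hα, hβ⟩

lemma BdaggerLiminf_le_relEntropy {ρ σ : Matrix d d ℂ} (hρ : IsDensity ρ) (hσ : σ.PosDef)
    (M : ∀ n, POVM (Ω n) (Fin n → d)) :
    BdaggerLiminf M ρ σ ≤ (relEntropy ρ σ : EReal) := by
  refine sSup_le ?_
  rintro _ ⟨r, ⟨T, hT, hα, hβ⟩, rfl⟩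
  refine EReal.coe_le_coe_iff.2 (le_of_not_gt fun hr => ?_)
  exact hα.not_ge (one_le_liminf_firstError hρ hσ M hT hr hβ)

end StrongConverse

end QuantumTesting

theorem theorem3 {d : Type*} [Fintype d] [DecidableEq d] (ρ σ : Matrix d d ℂ)
    (hρ : QuantumTesting.IsDensity ρ) (hσ : QuantumTesting.IsDensity σ) (hσ_inv : IsUnit σ)
    {Ω : ℕ → Type*} (M : ∀ n, QuantumTesting.POVM (Ω n) (Fin n → d)) :
    QuantumTesting.Bdagger M ρ σ ≤ (QuantumTesting.relEntropy ρ σ : EReal) ∧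
      QuantumTesting.BdaggerLiminf M ρ σ ≤ (QuantumTesting.relEntropy ρ σ : EReal) := by
  have h := QuantumTesting.BdaggerLiminf_le_relEntropy hρ
    (hσ.posSemidef.posDef_iff_isUnit.2 hσ_inv) M
  exact ⟨(QuantumTesting.Bdagger_le_BdaggerLiminf M ρ σ).trans h, h⟩
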